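/- Let $d\in\mathbb N$ and let $\mathbb W$ be the Weyl $C^*$-algebra with $d$ degrees of freedom, i.e. the completion of the unital $*$-algebra spanned by the monomials $u_\alpha v_\beta$ ($\alpha,\beta\in\mathbb R^d$), with $$u_\alpha v_\beta=e^{i\alpha\cdot\beta}v_\beta u_\alpha,\quad u_\alpha u_{\alpha'}=u_{\alpha+\alpha'},\quad v_\beta v_{\beta'}=v_{\beta+\beta'},\quad u_\alpha^*=u_{-\alpha},\quad v_\beta^*=v_{-\beta},$$ in the norm $\|a\|=\sup_\rho\|\rho(a)\|$, where $\rho$ runs over all $*$-representations by bounded operators on Hilbert spaces. A state on $\mathbb W$ is a positive linear functional $\omega$ with $\omega(\mathbf 1)=1$, and it is pure if it is an extreme point of the set of states. Let $\mathscr P^\tau_{\mathbb W}$ be the set of all pure states (no regularity is assumed) that are translation invariant, i.e. $\omega(v_\lambda a v_\lambda^*)=\omega(a)$ for all $\lambda\in\mathbb R^d$ and $a\in\mathbb W$. Let $\mathfrak c:\mathbb W\to\mathbb W$ be time reversal, the antilinear multiplicative $*$-preserving involution with $\mathfrak c(u_\alpha)=u_{-\alpha}$ and $\mathfrak c(v_\beta)=v_\beta$.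 A state $\omega$ is time-reversal invariant if $\overline{\omega(a)}=\omega(\mathfrak c(a))$ for all $a\in\mathbb W$. Then there is exactly one state $\omega_0$ on $\mathbb W$ (the zero-momentum state) with $\omega_0(u_\alpha v_\beta)=\delta_{\alpha,0}$ for all $\alpha,\beta\in\mathbb R^d$, and $\omega_0$ is the unique element of $\mathscr P^\tau_{\mathbb W}$ which is time-reversal invariant: $$\{\omega\in\mathscr P^\tau_{\mathbb W} : \omega \text{ is time-reversal invariant}\}=\{\omega_0\}.$$ -/

import Mathlib

open scoped ENNReal ComplexConjugate ComplexOrder InnerProductSpace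

noncomputable section

/-! ### Conjugations on complex Hilbert spaces -/

section Conjugation

variable {H : Type} [NormedAddCommGroup H] [InnerProductSpace ℂ H] [CompleteSpace H]

/-- Complex conjugation of the coordinates with respect to a (chosen) Hilbert basis: an antilinear
isometric involution of `H`. -/
def hilbertConj (H : Type) [NormedAddCommGroup H] [InnerProductSpace ℂ H] [CompleteSpace H] :
    H ≃ₗᵢ⋆[ℂ] H :=
  let b := (exists_hilbertBasis ℂ H).choose_spec.choose
  (b.repr.trans (starₗᵢ ℂ)).trans b.repr.symm

theorem hilbertConj_hilbertConj (x : H) : hilbertConj H (hilbertConj H x) = x := by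
  simp [hilbertConj]

theorem hilbertConj_symm : (hilbertConj H).symm = hilbertConj H := by
  ext x
  rw [LinearIsometryEquiv.symm_apply_eq, hilbertConj_hilbertConj]

theorem inner_hilbertConj (x y : H) : ⟪hilbertConj H x, hilbertConj H y⟫_ℂ = ⟪y, x⟫_ℂ := by
  have key : ∀ f g : lp (fun _ : (exists_hilbertBasis ℂ H).choose => ℂ) 2, ⟪star f, star g⟫_ℂ = ⟪g, f⟫_ℂ := by
    intro f g
    rw [lp.inner_eq_tsum, lp.inner_eq_tsum]
    refine tsum_congr fun i => ?_
    simp [mul_comm]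
  simp only [hilbertConj, LinearIsometryEquiv.trans_apply, LinearIsometryEquiv.inner_map_map]
  exact (key _ _).trans (LinearIsometryEquiv.inner_map_map _ _ _)

/-- The operator `J T J`, where `J` is the conjugation of `H`. -/
def conjOp (T : H →L[ℂ] H) : H →L[ℂ] H :=
  ((hilbertConj H : H ≃ₗᵢ⋆[ℂ] H) : H →SL[starRingEnd ℂ] H).comp
    (T.comp ((hilbertConj H : H ≃ₗᵢ⋆[ℂ] H) : H →SL[starRingEnd ℂ] H))

theorem conjOp_apply (T : H →L[ℂ] H) (x : H) :
    conjOp T x = hilbertConj H (T (hilbertConj H x)) := rfl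

theorem conjOp_conjOp (T : H →L[ℂ] H) : conjOp (conjOp T) = T := by
  ext x; simp [conjOp_apply, hilbertConj_hilbertConj]

theorem conjOp_one : conjOp (1 : H →L[ℂ] H) = 1 := by
  ext x; simp [conjOp_apply, hilbertConj_hilbertConj]

theorem conjOp_add (S T : H →L[ℂ] H) : conjOp (S + T) = conjOp S + conjOp T := by
  ext x; simp [conjOp_apply]

theorem conjOp_smul (z : ℂ) (T : H →L[ℂ] H) : conjOp (z • T) = conj z • conjOp T := by
  ext x
  exact (hilbertConj H).map_smulₛₗ z _

theorem conjOp_mul (S T : H →L[ℂ] H) : conjOp (S * T) = conjOp S * conjOp T := by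
  ext x; simp [conjOp_apply, hilbertConj_hilbertConj]

theorem conjOp_star (T : H →L[ℂ] H) : conjOp (star T) = star (conjOp T) := by
  rw [ContinuousLinearMap.star_eq_adjoint, ContinuousLinearMap.star_eq_adjoint,
    ContinuousLinearMap.eq_adjoint_iff]
  intro x y
  rw [conjOp_apply, conjOp_apply]
  nth_rewrite 1 [← hilbertConj_hilbertConj y]
  rw [inner_hilbertConj, ContinuousLinearMap.adjoint_inner_right]
  nth_rewrite 2 [← hilbertConj_hilbertConj x]
  rw [inner_hilbertConj]

theorem norm_conjOp_le (T : H →L[ℂ] H) : ‖conjOp T‖ ≤ ‖T‖ := by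
  refine ContinuousLinearMap.opNorm_le_bound _ (norm_nonneg _) fun x => ?_
  rw [conjOp_apply, LinearIsometryEquiv.norm_map]
  simpa using T.le_opNorm (hilbertConj H x)

theorem norm_conjOp (T : H →L[ℂ] H) : ‖conjOp T‖ = ‖T‖ := by
  refine le_antisymm (norm_conjOp_le T) ?_
  simpa [conjOp_conjOp] using norm_conjOp_le (conjOp T)

end Conjugation

/-! ### The Weyl C*-algebra -/

/-- A representation of the Weyl relations (equivalently, a unital `*`-representation of the Weyl
`*`-algebra spanned by the monomials `u_α v_β`) by bounded operators on a nonzero complex Hilbert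
space: `U α V β = exp (i α·β) V β U α`, `U α U α' = U (α + α')`, `V β V β' = V (β + β')`,
`(U α)* = U (-α)`, `(V β)* = V (-β)`. -/
structure WeylRep (d : ℕ) where
  H : Type
  [normed : NormedAddCommGroup H]
  [innerProduct : InnerProductSpace ℂ H]
  [complete : CompleteSpace H]
  [nontriv : Nontrivial H]
  U : EuclideanSpace ℝ (Fin d) → H →L[ℂ] H
  V : EuclideanSpace ℝ (Fin d) → H →L[ℂ] H
  U_zero : U 0 = 1
  V_zero : V 0 = 1
  U_add : ∀ α α', U α * U α' = U (α + α')
  V_add : ∀ β β', V β * V β' = V (β + β')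
  U_star : ∀ α, star (U α) = U (-α)
  V_star : ∀ β, star (V β) = V (-β)
  weyl : ∀ α β, U α * V β = Complex.exp (Complex.I * (⟪α, β⟫_ℝ : ℝ)) • (V β * U α)

attribute [instance] WeylRep.normed WeylRep.innerProduct WeylRep.complete WeylRep.nontriv

namespace WeylRep

variable {d : ℕ}

theorem norm_U (ρ : WeylRep d) (α : EuclideanSpace ℝ (Fin d)) : ‖ρ.U α‖ = 1 := by
  have h : ρ.U α ∈ unitary (ρ.H →L[ℂ] ρ.H) := by
    rw [Unitary.mem_iff, ρ.U_star, ρ.U_add, ρ.U_add]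
    simp [ρ.U_zero]
  exact CStarRing.norm_of_mem_unitary h

theorem norm_V (ρ : WeylRep d) (β : EuclideanSpace ℝ (Fin d)) : ‖ρ.V β‖ = 1 := by
  have h : ρ.V β ∈ unitary (ρ.H →L[ℂ] ρ.H) := by
    rw [Unitary.mem_iff, ρ.V_star, ρ.V_add, ρ.V_add]
    simp [ρ.V_zero]
  exact CStarRing.norm_of_mem_unitary h

/-- The representation `u_α ↦ J U(-α) J`, `v_β ↦ J V(β) J` on the same Hilbert space. -/
@[reducible] def timeReverse (ρ : WeylRep d) : WeylRep d where
  H := ρ.H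
  U α := conjOp (ρ.U (-α))
  V β := conjOp (ρ.V β)
  U_zero := by rw [neg_zero, ρ.U_zero, conjOp_one]
  V_zero := by rw [ρ.V_zero, conjOp_one]
  U_add α α' := by rw [← conjOp_mul, ρ.U_add, neg_add]
  V_add β β' := by rw [← conjOp_mul, ρ.V_add]
  U_star α := by rw [← conjOp_star, ρ.U_star]
  V_star β := by rw [← conjOp_star, ρ.V_star]
  weyl α β := by
    rw [← conjOp_mul, ρ.weyl, conjOp_smul, conjOp_mul, ← Complex.exp_conj]
    simp

end WeylRep

/-- The C*-algebra of bounded families of operators, one for each representation of the Weyl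
relations, with pointwise operations and the supremum norm. -/
def WeylProduct (d : ℕ) : Type 1 := lp (fun ρ : WeylRep d => ρ.H →L[ℂ] ρ.H) ∞

/-- A bounded product of unital C*-algebras, as a C*-algebra. -/
@[reducible] def lpInftyCStarAlgebra {I : Type*} (B : I → Type*) [∀ i, CStarAlgebra (B i)]
    [∀ i, NormOneClass (B i)] : CStarAlgebra (lp B ∞) where

instance WeylProduct.instCStarAlgebra (d : ℕ) : CStarAlgebra (WeylProduct d) :=
  lpInftyCStarAlgebra (fun ρ : WeylRep d => ρ.H →L[ℂ] ρ.H)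

namespace WeylProduct

variable {d : ℕ}

/-- The component `ρ(x)` of a bounded family `x`. -/
def eval (ρ : WeylRep d) (x : WeylProduct d) : ρ.H →L[ℂ] ρ.H := x.1 ρ

@[ext] theorem ext {x y : WeylProduct d} (h : ∀ ρ, x.eval ρ = y.eval ρ) : x = y :=
  lp.ext (funext h)

theorem norm_eval_le (ρ : WeylRep d) (x : WeylProduct d) : ‖x.eval ρ‖ ≤ ‖x‖ :=
  lp.norm_apply_le_norm ENNReal.top_ne_zero _ ρ

theorem norm_eq_iSup (x : WeylProduct d) : ‖x‖ = ⨆ ρ, ‖x.eval ρ‖ :=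
  lp.norm_eq_ciSup _

theorem norm_le_of_forall_le {x : WeylProduct d} {C : ℝ} (hC : 0 ≤ C)
    (h : ∀ ρ, ‖x.eval ρ‖ ≤ C) : ‖x‖ ≤ C :=
  lp.norm_le_of_forall_le hC h

variable (ρ : WeylRep d) (x y : WeylProduct d)

theorem eval_one : (1 : WeylProduct d).eval ρ = 1 := rfl

theorem eval_add : (x + y).eval ρ = x.eval ρ + y.eval ρ := rfl

theorem eval_mul : (x * y).eval ρ = x.eval ρ * y.eval ρ := rfl

theorem eval_smul (z : ℂ) : (z • x).eval ρ = z • x.eval ρ := rfl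

theorem eval_star : (star x).eval ρ = star (x.eval ρ) := rfl

attribute [irreducible] WeylProduct.instCStarAlgebra

end WeylProduct

/-- The family `(U_ρ(α))_ρ`. -/
def weylProductU {d : ℕ} (α : EuclideanSpace ℝ (Fin d)) : WeylProduct d :=
  ⟨fun ρ => ρ.U α, memℓp_infty ⟨1, by rintro _ ⟨ρ, rfl⟩; exact (ρ.norm_U α).le⟩⟩

/-- The family `(V_ρ(β))_ρ`. -/
def weylProductV {d : ℕ} (β : EuclideanSpace ℝ (Fin d)) : WeylProduct d :=
  ⟨fun ρ => ρ.V β, memℓp_infty ⟨1, by rintro _ ⟨ρ, rfl⟩; exact (ρ.norm_V β).le⟩⟩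

/-- The norm closure of the `*`-algebra generated by the `u_α` and `v_β` under the norm
`‖a‖ = sup_ρ ‖ρ(a)‖`, the supremum being over all representations of the Weyl relations. -/
def weylSubalgebra (d : ℕ) : StarSubalgebra ℂ (WeylProduct d) :=
  (StarAlgebra.adjoin ℂ (Set.range (weylProductU (d := d)) ∪
    Set.range (weylProductV (d := d)))).topologicalClosure

theorem isClosed_weylSubalgebra (d : ℕ) :
    IsClosed (weylSubalgebra d : Set (WeylProduct d)) :=
  StarSubalgebra.isClosed_topologicalClosure _

/-- The abstract Weyl C*-algebra with `d` degrees of freedom: the completion of the Weyl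
`*`-algebra in the norm `‖a‖ = sup_ρ ‖ρ(a)‖`. -/
def WeylAlgebra (d : ℕ) : Type 1 := weylSubalgebra d

namespace WeylAlgebra

variable {d : ℕ}

instance instCStarAlgebra (d : ℕ) : CStarAlgebra (WeylAlgebra d) :=
  StarSubalgebra.cstarAlgebra (weylSubalgebra d) (h_closed := isClosed_weylSubalgebra d)

/-- The inclusion of the Weyl algebra in the product, as a `*`-homomorphism. -/
def toProduct : WeylAlgebra d →⋆ₐ[ℂ] WeylProduct d := (weylSubalgebra d).subtype

theorem toProduct_injective : Function.Injective (toProduct (d := d)) := Subtype.val_injective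

theorem isometry_toProduct : Isometry (toProduct (d := d)) := fun _ _ => rfl

theorem toProduct_mem (a : WeylAlgebra d) : toProduct a ∈ weylSubalgebra d := a.2

/-- An element of the closed subalgebra as an element of the Weyl algebra. -/
def mk (x : WeylProduct d) (hx : x ∈ weylSubalgebra d) : WeylAlgebra d := ⟨x, hx⟩

theorem toProduct_mk (x : WeylProduct d) (hx : x ∈ weylSubalgebra d) :
    toProduct (mk x hx) = x := rfl

attribute [irreducible] instCStarAlgebra

/-- The representation of the Weyl algebra given by `ρ`, as a map to bounded operators. -/
def eval (ρ : WeylRep d) (a : WeylAlgebra d) : ρ.H →L[ℂ] ρ.H := (toProduct a).eval ρ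

theorem ext {a b : WeylAlgebra d} (h : ∀ ρ, a.eval ρ = b.eval ρ) : a = b :=
  toProduct_injective (WeylProduct.ext h)

/-- The norm of the Weyl algebra is the supremum of the norms in all representations. -/
theorem norm_eq_iSup (a : WeylAlgebra d) : ‖a‖ = ⨆ ρ : WeylRep d, ‖a.eval ρ‖ := by
  rw [← AddMonoidHomClass.isometry_iff_norm toProduct |>.1 isometry_toProduct a]
  exact WeylProduct.norm_eq_iSup _

theorem eval_one (ρ : WeylRep d) : (1 : WeylAlgebra d).eval ρ = 1 := by
  rw [eval, map_one, WeylProduct.eval_one]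

theorem eval_add (ρ : WeylRep d) (a b : WeylAlgebra d) :
    (a + b).eval ρ = a.eval ρ + b.eval ρ := by
  rw [eval, map_add, WeylProduct.eval_add]; rfl

theorem eval_mul (ρ : WeylRep d) (a b : WeylAlgebra d) :
    (a * b).eval ρ = a.eval ρ * b.eval ρ := by
  rw [eval, map_mul, WeylProduct.eval_mul]; rfl

theorem eval_smul (ρ : WeylRep d) (z : ℂ) (a : WeylAlgebra d) :
    (z • a).eval ρ = z • a.eval ρ := by
  rw [eval, map_smul, WeylProduct.eval_smul]; rfl

theorem eval_star (ρ : WeylRep d) (a : WeylAlgebra d) :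
    (star a).eval ρ = star (a.eval ρ) := by
  rw [eval, map_star, WeylProduct.eval_star]; rfl

/-- The generator `u_α`. -/
def u (α : EuclideanSpace ℝ (Fin d)) : WeylAlgebra d :=
  mk (weylProductU α) (StarSubalgebra.le_topologicalClosure _
    (StarAlgebra.subset_adjoin ℂ _ (Or.inl ⟨α, rfl⟩)))

/-- The generator `v_β`. -/
def v (β : EuclideanSpace ℝ (Fin d)) : WeylAlgebra d :=
  mk (weylProductV β) (StarSubalgebra.le_topologicalClosure _
    (StarAlgebra.subset_adjoin ℂ _ (Or.inr ⟨β, rfl⟩)))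

theorem eval_u (ρ : WeylRep d) (α : EuclideanSpace ℝ (Fin d)) : (u α).eval ρ = ρ.U α := rfl

theorem eval_v (ρ : WeylRep d) (β : EuclideanSpace ℝ (Fin d)) : (v β).eval ρ = ρ.V β := rfl

theorem u_zero : u (0 : EuclideanSpace ℝ (Fin d)) = 1 :=
  ext fun ρ => by rw [eval_u, eval_one, ρ.U_zero]

theorem v_zero : v (0 : EuclideanSpace ℝ (Fin d)) = 1 :=
  ext fun ρ => by rw [eval_v, eval_one, ρ.V_zero]

theorem u_mul_u (α α' : EuclideanSpace ℝ (Fin d)) : u α * u α' = u (α + α') :=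
  ext fun ρ => by rw [eval_mul, eval_u, eval_u, eval_u, ρ.U_add]

theorem v_mul_v (β β' : EuclideanSpace ℝ (Fin d)) : v β * v β' = v (β + β') :=
  ext fun ρ => by rw [eval_mul, eval_v, eval_v, eval_v, ρ.V_add]

theorem star_u (α : EuclideanSpace ℝ (Fin d)) : star (u α) = u (-α) :=
  ext fun ρ => by rw [eval_star, eval_u, eval_u, ρ.U_star]

theorem star_v (β : EuclideanSpace ℝ (Fin d)) : star (v β) = v (-β) :=
  ext fun ρ => by rw [eval_star, eval_v, eval_v, ρ.V_star]

theorem u_mul_v (α β : EuclideanSpace ℝ (Fin d)) :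
    u α * v β = Complex.exp (Complex.I * (⟪α, β⟫_ℝ : ℝ)) • (v β * u α) :=
  ext fun ρ => by rw [eval_mul, eval_smul, eval_mul, eval_u, eval_v, ρ.weyl]

end WeylAlgebra

/-! ### Time reversal -/

/-- The antilinear map on bounded families of operators that induces time reversal. -/
def productTimeReversal {d : ℕ} (x : WeylProduct d) : WeylProduct d :=
  ⟨fun ρ => conjOp (H := ρ.H) (x.eval ρ.timeReverse), memℓp_infty ⟨‖x‖, by
    rintro _ ⟨ρ, rfl⟩
    exact (norm_conjOp_le (H := ρ.H) _).trans (x.norm_eval_le ρ.timeReverse)⟩⟩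

section ProductTimeReversal

variable {d : ℕ}

theorem productTimeReversal_eval (x : WeylProduct d) (ρ : WeylRep d) :
    (productTimeReversal x).eval ρ = conjOp (H := ρ.H) (x.eval ρ.timeReverse) := rfl

theorem productTimeReversal_add (x y : WeylProduct d) :
    productTimeReversal (x + y) = productTimeReversal x + productTimeReversal y :=
  WeylProduct.ext fun ρ => by
    rw [WeylProduct.eval_add, productTimeReversal_eval, WeylProduct.eval_add]
    exact conjOp_add (H := ρ.H) _ _

theorem productTimeReversal_smul (z : ℂ) (x : WeylProduct d) :
    productTimeReversal (z • x) = conj z • productTimeReversal x :=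
  WeylProduct.ext fun ρ => by
    rw [WeylProduct.eval_smul, productTimeReversal_eval, WeylProduct.eval_smul]
    exact conjOp_smul (H := ρ.H) z _

theorem productTimeReversal_mul (x y : WeylProduct d) :
    productTimeReversal (x * y) = productTimeReversal x * productTimeReversal y :=
  WeylProduct.ext fun ρ => by
    rw [WeylProduct.eval_mul, productTimeReversal_eval, WeylProduct.eval_mul]
    exact conjOp_mul (H := ρ.H) _ _

theorem productTimeReversal_star (x : WeylProduct d) :
    productTimeReversal (star x) = star (productTimeReversal x) :=
  WeylProduct.ext fun ρ => by
    rw [WeylProduct.eval_star, productTimeReversal_eval, WeylProduct.eval_star]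
    exact conjOp_star (H := ρ.H) _

theorem productTimeReversal_one : productTimeReversal (1 : WeylProduct d) = 1 :=
  WeylProduct.ext fun ρ => by
    rw [productTimeReversal_eval, WeylProduct.eval_one, WeylProduct.eval_one]
    exact conjOp_one (H := ρ.H)

theorem productTimeReversal_U (α : EuclideanSpace ℝ (Fin d)) :
    productTimeReversal (weylProductU α) = weylProductU (-α) :=
  WeylProduct.ext fun ρ => conjOp_conjOp (H := ρ.H) _

theorem productTimeReversal_V (β : EuclideanSpace ℝ (Fin d)) :
    productTimeReversal (weylProductV β) = weylProductV β :=
  WeylProduct.ext fun ρ => conjOp_conjOp (H := ρ.H) _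

theorem norm_productTimeReversal_le (x : WeylProduct d) : ‖productTimeReversal x‖ ≤ ‖x‖ :=
  WeylProduct.norm_le_of_forall_le (norm_nonneg x) fun ρ =>
    (norm_conjOp_le (H := ρ.H) _).trans (x.norm_eval_le ρ.timeReverse)

theorem productTimeReversal_sub (x y : WeylProduct d) :
    productTimeReversal (x - y) = productTimeReversal x - productTimeReversal y := by
  rw [eq_sub_iff_add_eq, ← productTimeReversal_add, sub_add_cancel]

theorem continuous_productTimeReversal : Continuous (productTimeReversal (d := d)) := by
  refine (LipschitzWith.of_dist_le_mul (K := 1) fun x y => ?_).continuous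
  rw [dist_eq_norm, dist_eq_norm, ← productTimeReversal_sub, NNReal.coe_one, one_mul]
  exact norm_productTimeReversal_le _

theorem productTimeReversal_mem {x : WeylProduct d} (hx : x ∈ weylSubalgebra d) :
    productTimeReversal x ∈ weylSubalgebra d := by
  have key : Set.MapsTo (productTimeReversal (d := d))
      (StarAlgebra.adjoin ℂ (Set.range (weylProductU (d := d)) ∪
        Set.range (weylProductV (d := d))) : Set (WeylProduct d))
      (StarAlgebra.adjoin ℂ (Set.range (weylProductU (d := d)) ∪
        Set.range (weylProductV (d := d))) : Set (WeylProduct d)) := by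
    intro y hy
    refine StarAlgebra.adjoin_induction (R := ℂ)
      (p := fun y _ => productTimeReversal y ∈ StarAlgebra.adjoin ℂ
        (Set.range (weylProductU (d := d)) ∪ Set.range (weylProductV (d := d))))
      ?_ ?_ ?_ ?_ ?_ hy
    · rintro _ (⟨α, rfl⟩ | ⟨β, rfl⟩)
      · rw [productTimeReversal_U]
        exact StarAlgebra.subset_adjoin ℂ _ (Or.inl ⟨_, rfl⟩)
      · rw [productTimeReversal_V]
        exact StarAlgebra.subset_adjoin ℂ _ (Or.inr ⟨_, rfl⟩)
    · intro z
      rw [Algebra.algebraMap_eq_smul_one, productTimeReversal_smul, productTimeReversal_one]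
      exact SMulMemClass.smul_mem _ (one_mem _)
    · intro a b _ _ ha hb
      rw [productTimeReversal_add]
      exact add_mem ha hb
    · intro a b _ _ ha hb
      rw [productTimeReversal_mul]
      exact mul_mem ha hb
    · intro a _ ha
      rw [productTimeReversal_star]
      exact star_mem ha
  exact key.closure continuous_productTimeReversal hx

end ProductTimeReversal

namespace WeylAlgebra

variable {d : ℕ}

/-- Time reversal `𝔠`: the continuous antilinear multiplicative `*`-map of the Weyl C*-algebra
with `𝔠(u_α) = u_{-α}` and `𝔠(v_β) = v_β`. -/
def timeReversal (a : WeylAlgebra d) : WeylAlgebra d :=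
  mk (productTimeReversal (toProduct a)) (productTimeReversal_mem (toProduct_mem a))

theorem toProduct_timeReversal (a : WeylAlgebra d) :
    toProduct (timeReversal a) = productTimeReversal (toProduct a) := rfl

theorem timeReversal_add (a b : WeylAlgebra d) :
    timeReversal (a + b) = timeReversal a + timeReversal b :=
  toProduct_injective (by simp only [toProduct_timeReversal, map_add, productTimeReversal_add])

theorem timeReversal_smul (z : ℂ) (a : WeylAlgebra d) :
    timeReversal (z • a) = conj z • timeReversal a :=
  toProduct_injective (by simp only [toProduct_timeReversal, map_smul, productTimeReversal_smul])

theorem timeReversal_mul (a b : WeylAlgebra d) :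
    timeReversal (a * b) = timeReversal a * timeReversal b :=
  toProduct_injective (by simp only [toProduct_timeReversal, map_mul, productTimeReversal_mul])

theorem timeReversal_star (a : WeylAlgebra d) :
    timeReversal (star a) = star (timeReversal a) :=
  toProduct_injective (by simp only [toProduct_timeReversal, map_star, productTimeReversal_star])

theorem timeReversal_u (α : EuclideanSpace ℝ (Fin d)) : timeReversal (u α) = u (-α) :=
  toProduct_injective (productTimeReversal_U α)

theorem timeReversal_v (β : EuclideanSpace ℝ (Fin d)) : timeReversal (v β) = v β :=
  toProduct_injective (productTimeReversal_V β)

theorem continuous_timeReversal : Continuous (timeReversal (d := d)) := by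
  rw [isometry_toProduct.isEmbedding.continuous_iff]
  exact continuous_productTimeReversal.comp isometry_toProduct.continuous

end WeylAlgebra

/-! ### States -/

/-- The states of a unital complex `*`-algebra: the normalized positive linear functionals. -/
def stateSpace (A : Type*) [Ring A] [StarRing A] [Algebra ℂ A] : Set (A →ₗ[ℂ] ℂ) :=
  {ω | (∀ a : A, 0 ≤ ω (star a * a)) ∧ ω 1 = 1}

/-- The pure states: the extreme points of the state space. -/
def pureStates (A : Type*) [Ring A] [StarRing A] [Algebra ℂ A] : Set (A →ₗ[ℂ] ℂ) :=
  (stateSpace A).extremePoints ℝ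

namespace WeylAlgebra

variable {d : ℕ}

/-- The space translation `τ_x(a) = v_x a v_x*`. -/
def translation (x : EuclideanSpace ℝ (Fin d)) (a : WeylAlgebra d) : WeylAlgebra d :=
  v x * a * star (v x)

/-- The translation-invariant states. -/
def invariantStates (d : ℕ) : Set (WeylAlgebra d →ₗ[ℂ] ℂ) :=
  {ω | ω ∈ stateSpace (WeylAlgebra d) ∧ ∀ x a, ω (translation x a) = ω a}

/-- The translation-invariant pure states. -/
def pureInvariantStates (d : ℕ) : Set (WeylAlgebra d →ₗ[ℂ] ℂ) :=
  invariantStates d ∩ pureStates (WeylAlgebra d)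

/-- Time-reversal invariance of a functional: the complex conjugate of `ω(a)` is `ω(𝔠(a))`. -/
def IsTimeReversalInvariant (ω : WeylAlgebra d →ₗ[ℂ] ℂ) : Prop :=
  ∀ a, conj (ω a) = ω (timeReversal a)

open Classical in
/-- `ω` is the zero-momentum state: the state with `ω(u_α v_β) = δ_{α,0}`. -/
def IsZeroMomentumState (ω : WeylAlgebra d →ₗ[ℂ] ℂ) : Prop :=
  ω ∈ stateSpace (WeylAlgebra d) ∧ ∀ α β, ω (u α * v β) = if α = 0 then 1 else 0

end WeylAlgebra

end

open scoped ENNReal ComplexConjugate ComplexOrder InnerProductSpace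

noncomputable section

/-! ### States of C*-algebras -/

section States

variable {A : Type*} [CStarAlgebra A] {ω : A →ₗ[ℂ] ℂ}

/-! A state that takes the value one at a unitary `v` cannot distinguish `a v` from `a`: by
Cauchy-Schwarz, `v - 1` lies in its left kernel (`map_mul_eq_of_map_unitary_eq_one`). Hence a state
equal to one at every `v_β` is translation invariant. Translations multiply `u_α` by a phase that is
nontrivial for `α ≠ 0`, so the state vanishes there. Its values at the monomials are then forced,
and the monomials span a dense subspace.

For uniqueness, let `ω` be pure and translation invariant. Purity gives `ω (a v_β) = ω a * ω (v_β)`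
(`map_mul_unitary_of_mem_pureStates`), so `β ↦ ω (v_β)` is a unimodular character, possibly
discontinuous. Time reversal fixes `v_β` and makes the character real. Since every `β` can be
halved, each value is the square of a value `±1`, hence one.

For existence, take the vector state of `δ_0` in `ℓ²(ℝ^d)`, with `u_α` acting by shifts and `v_β` by
characters. It is pure because one is the largest possible real part of a state at `v_β`, so both
parts of a convex decomposition must attain it. It is invariant under time reversal because its
reverse is a state with the same values at the monomials. -/

theorem exists_positiveLinearMap_of_nonneg (hω : ∀ a, 0 ≤ ω (star a * a)) :
    letI := CStarAlgebra.spectralOrder A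
    ∃ f : A →ₚ[ℂ] ℂ, ∀ a, f a = ω a := by
  let := CStarAlgebra.spectralOrder A
  have := CStarAlgebra.spectralOrderedRing A
  refine ⟨PositiveLinearMap.mk₀ ω fun a ha => ?_, fun _ => rfl⟩
  obtain ⟨b, rfl⟩ := CStarAlgebra.nonneg_iff_eq_star_mul_self.mp ha
  exact hω b

theorem continuous_of_nonneg_star_mul_self (hω : ∀ a, 0 ≤ ω (star a * a)) : Continuous ω := by
  let := CStarAlgebra.spectralOrder A
  have := CStarAlgebra.spectralOrderedRing A
  obtain ⟨f, hf⟩ := exists_positiveLinearMap_of_nonneg hω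
  obtain ⟨C, hC⟩ := f.exists_norm_apply_le
  exact AddMonoidHomClass.continuous_of_bound ω C fun a => by rw [← hf]; exact hC a

theorem map_star_of_nonneg_star_mul_self (hω : ∀ a, 0 ≤ ω (star a * a)) (a : A) :
    ω (star a) = conj (ω a) := by
  let := CStarAlgebra.spectralOrder A
  have := CStarAlgebra.spectralOrderedRing A
  obtain ⟨f, hf⟩ := exists_positiveLinearMap_of_nonneg hω
  rw [← hf, ← hf, map_star, Complex.star_def]

/-- The null space of a positive functional is a left kernel (Cauchy-Schwarz). -/
theorem map_star_mul_eq_zero_of_nonneg (hω : ∀ a, 0 ≤ ω (star a * a)) {b : A}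
    (hb : ω (star b * b) = 0) (a : A) : ω (star a * b) = 0 := by
  let := CStarAlgebra.spectralOrder A
  have := CStarAlgebra.spectralOrderedRing A
  obtain ⟨f, hf⟩ := exists_positiveLinearMap_of_nonneg hω
  have h := norm_inner_le_norm (𝕜 := ℂ) (f.toPreGNS a) (f.toPreGNS b)
  have hb' : ‖f.toPreGNS b‖ = 0 := by
    rw [PositiveLinearMap.preGNS_norm_def, PositiveLinearMap.ofPreGNS_toPreGNS, hf, hb]
    simp
  rw [hb', mul_zero, PositiveLinearMap.preGNS_inner_def, hf] at h
  simpa using h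

/-- A state which takes the value one at a unitary `v` satisfies `ω (a v) = ω a`. -/
theorem map_mul_eq_of_map_unitary_eq_one (hω : ω ∈ stateSpace A) {v : A} (hv : star v * v = 1)
    (h : ω v = 1) (a : A) : ω (a * v) = ω a := by
  have hv' : ω (star v) = 1 := by rw [map_star_of_nonneg_star_mul_self hω.1, h, map_one]
  have hb : ω (star (v - 1) * (v - 1)) = 0 := by
    have e : star (v - 1) * (v - 1) = star v * v - star v - v + 1 := by
      simp only [star_sub, star_one]; noncomm_ring
    rw [e, hv, map_add, map_sub, map_sub, h, hv', hω.2]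
    norm_num
  have := map_star_mul_eq_zero_of_nonneg hω.1 hb (star a)
  rwa [star_star, mul_sub, mul_one, map_sub, sub_eq_zero] at this

/-- A positive functional dominated by a pure state is a multiple of that state. -/
theorem eq_smul_of_add_eq_of_mem_pureStates (hω : ω ∈ pureStates A) {φ ψ : A →ₗ[ℂ] ℂ}
    (hφ : ∀ a, 0 ≤ φ (star a * a)) (hψ : ∀ a, 0 ≤ ψ (star a * a)) (h : φ + ψ = ω)
    (hφ1 : 0 < φ 1) (hψ1 : 0 < ψ 1) (a : A) : φ a = φ 1 * ω a := by
  have normalize : ∀ {χ : A →ₗ[ℂ] ℂ}, (∀ a, 0 ≤ χ (star a * a)) → 0 < χ 1 →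
      (χ 1)⁻¹ • χ ∈ stateSpace A := fun {χ} hχ hχ1 =>
    ⟨fun a => mul_nonneg (inv_nonneg.mpr hχ1.le) (hχ a), by
      simp [inv_mul_cancel₀ hχ1.ne']⟩
  -- Extreme points are taken over `ℝ`, so the positive complex masses must be turned into real
  -- weights.
  have hre : ∀ {z : ℂ}, 0 < z → 0 < z.re ∧ (z.re : ℂ) = z := fun {z} hz =>
    ⟨(Complex.pos_iff.mp hz).1, Complex.ext rfl (Complex.pos_iff.mp hz).2⟩
  obtain ⟨hs, hs'⟩ := hre hφ1
  obtain ⟨ht, ht'⟩ := hre hψ1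
  have hsum : φ 1 + ψ 1 = 1 := by rw [← LinearMap.add_apply, h, hω.1.2]
  have key : (φ 1)⁻¹ • φ = ω := by
    refine hω.2 (normalize hφ hφ1) (normalize hψ hψ1) ⟨_, _, hs, ht, ?_, ?_⟩
    · exact_mod_cast (by rw [Complex.ofReal_add, hs', ht', hsum, Complex.ofReal_one] :
        (((φ 1).re + (ψ 1).re : ℝ) : ℂ) = (1 : ℝ))
    · ext b
      rw [← h]
      simp only [LinearMap.add_apply, LinearMap.smul_apply, Complex.real_smul, hs', ht',
        smul_eq_mul, mul_inv_cancel_left₀ hφ1.ne', mul_inv_cancel_left₀ hψ1.ne']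
  rw [← key]
  simp [mul_inv_cancel_left₀ hφ1.ne']

/-- A pure state invariant under conjugation by a unitary `v` is multiplicative at `v`. -/
theorem map_mul_unitary_of_mem_pureStates (hω : ω ∈ pureStates A) {v : A}
    (hv : v * star v = 1) (hinv : ∀ a, ω (v * a * star v) = ω a) (a : A) :
    ω (a * v) = ω a * ω v := by
  have hinv' : ∀ a, ω (star v * a * v) = ω a := fun a => by
    rw [← hinv (star v * a * v)]
    congr 1
    simp only [← mul_assoc, hv, one_mul]
    rw [mul_assoc, hv, mul_one]
  -- The positive functionals `a ↦ ω (b* a b)`, for `b = s + z v` with `|z| = 1`, will be the pieces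
  -- of a decomposition of `ω`.
  let φ (b : A) : A →ₗ[ℂ] ℂ := ω ∘ₗ LinearMap.mulLeft ℂ (star b) ∘ₗ LinearMap.mulRight ℂ b
  have φ_apply : ∀ b a, φ b a = ω (star b * (a * b)) := fun _ _ => rfl
  have φ_pos : ∀ b a, 0 ≤ φ b (star a * a) := fun b a => by
    rw [φ_apply]
    have := hω.1.1 (a * b)
    rwa [star_mul, mul_assoc, ← mul_assoc (star a)] at this
  have expand : ∀ (s z : ℂ), z * conj z = 1 → ∀ a, φ (s • 1 + z • v) a =
      (conj s * s + 1) * ω a + conj s * z * ω (a * v) + s * conj z * ω (star v * a) := by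
    intro s z hz a
    rw [φ_apply]
    have e : star (s • 1 + z • v) * (a * (s • 1 + z • v)) =
        (conj s * s) • a + (conj s * z) • (a * v) + (s * conj z) • (star v * a) +
          (z * conj z) • (star v * a * v) := by
      simp only [star_add, star_smul, star_one, add_mul, mul_add, smul_mul_assoc, mul_smul_comm,
        one_mul, mul_one, smul_add, smul_smul, Complex.star_def, mul_assoc]
      rw [mul_comm s (conj s), mul_comm z (conj s)]
      abel
    rw [e]
    simp only [map_add, map_smul, smul_eq_mul, hinv', hz]
    ring
  -- The scalar 2 keeps the mass strictly positive: it is `5 + 4 Re (z ω v)`, that is, one plus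
  -- twice the nonnegative mass for the scalar 1.
  have positive : ∀ z : ℂ, z * conj z = 1 → 0 < φ ((2 : ℂ) • 1 + z • v) 1 := by
    intro z hz
    have h0 : 0 ≤ φ ((1 : ℂ) • 1 + z • v) 1 := by
      simpa using φ_pos ((1 : ℂ) • 1 + z • v) 1
    have e : φ ((2 : ℂ) • 1 + z • v) 1 = 1 + 2 * φ ((1 : ℂ) • 1 + z • v) 1 := by
      rw [expand _ _ hz, expand _ _ hz, hω.1.2, map_one, map_ofNat]
      ring
    rw [e]
    exact add_pos_of_pos_of_nonneg one_pos (mul_nonneg zero_le_two h0)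
  have relation : ∀ z : ℂ, z * conj z = 1 →
      z * ω (a * v) + conj z * ω (star v * a) = (z * ω v + conj z * ω (star v)) * ω a := by
    intro z hz
    have hz' : -z * conj (-z) = 1 := by rw [map_neg, neg_mul_neg, hz]
    -- The cross terms of `2 + z v` and `2 - z v` cancel and the rest adds up to `2 (4 + 1) ω`,
    -- hence the factor `1 / 10`.
    have tenth : (0 : ℂ) < 1 / 10 := by norm_num
    have := eq_smul_of_add_eq_of_mem_pureStates hω
      (φ := (1 / 10 : ℂ) • φ ((2 : ℂ) • 1 + z • v)) (ψ := (1 / 10 : ℂ) • φ ((2 : ℂ) • 1 + (-z) • v))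
      (fun b => mul_nonneg tenth.le (φ_pos _ b)) (fun b => mul_nonneg tenth.le (φ_pos _ b))
      (by
        ext b
        simp only [LinearMap.add_apply, LinearMap.smul_apply, expand _ _ hz, expand _ _ hz',
          smul_eq_mul, map_neg, map_ofNat]
        ring)
      (mul_pos tenth (positive z hz)) (mul_pos tenth (positive _ hz')) a
    simp only [LinearMap.smul_apply, expand _ _ hz, smul_eq_mul, map_ofNat, hω.1.2, one_mul,
      mul_one] at this
    linear_combination 5 * this
  -- Polarization: `z = 1` and `z = I` separate the term in `a v` from the term in `star v * a`.
  have h1 := relation 1 (by simp)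
  have hI := relation Complex.I (by simp)
  simp only [map_one, Complex.conj_I] at h1 hI
  have h2 : (2 : ℂ) * ω (a * v) = 2 * (ω a * ω v) := by
    linear_combination h1 - Complex.I * hI +
      (ω (a * v) - ω (star v * a) - ω v * ω a + ω (star v) * ω a) * Complex.I_sq
  exact mul_left_cancel₀ two_ne_zero h2

end States

/-! ### The zero-momentum representation -/

section WeightedPerm

variable {ι : Type}

/-- The isometry `f ↦ (k ↦ c k * f (σ k))` of `ℓ²(ι)` for unimodular weights `c`. -/
def weightedPerm (c : ι → Circle) (σ : Equiv.Perm ι) :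
    lp (fun _ : ι => ℂ) 2 →ₗᵢ[ℂ] lp (fun _ : ι => ℂ) 2 where
  toFun f := ⟨fun k => (c k : ℂ) * f (σ k), by
    have h := (memℓp_gen_iff (by norm_num)).mp (lp.memℓp f)
    refine (memℓp_gen_iff (by norm_num)).mpr ?_
    simpa [Function.comp_def, Circle.norm_coe] using σ.summable_iff.mpr h⟩
  map_add' f g := by ext k; exact mul_add _ _ _
  map_smul' z f := by ext k; exact mul_left_comm _ _ _
  norm_map' f := by
    have h : (0 : ℝ) < (2 : ℝ≥0∞).toReal := by norm_num
    rw [lp.norm_eq_tsum_rpow h, lp.norm_eq_tsum_rpow h]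
    congr 1
    refine (tsum_congr fun k => ?_).trans (σ.tsum_eq fun k => ‖f k‖ ^ (2 : ℝ≥0∞).toReal)
    change ‖(c k : ℂ) * f (σ k)‖ ^ _ = _
    rw [norm_mul, Circle.norm_coe, one_mul]

theorem weightedPerm_apply (c : ι → Circle) (σ : Equiv.Perm ι) (f : lp (fun _ : ι => ℂ) 2)
    (k : ι) : weightedPerm c σ f k = (c k : ℂ) * f (σ k) := rfl

/-- Reindexing the inner product by `σ` moves the weight to the other argument, conjugated; for a
unimodular weight this is the inverse. -/
theorem star_weightedPerm (c : ι → Circle) (σ : Equiv.Perm ι) :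
    star (weightedPerm c σ).toContinuousLinearMap =
      (weightedPerm (fun k => (c (σ.symm k))⁻¹) σ.symm).toContinuousLinearMap := by
  rw [ContinuousLinearMap.star_eq_adjoint, eq_comm, ContinuousLinearMap.eq_adjoint_iff]
  intro f g
  rw [lp.inner_eq_tsum, lp.inner_eq_tsum, ← σ.tsum_eq]
  refine tsum_congr fun k => ?_
  simp only [LinearIsometry.coe_toContinuousLinearMap, weightedPerm_apply, RCLike.inner_apply,
    Equiv.symm_apply_apply, map_mul, Circle.coe_inv_eq_conj, Complex.conj_conj]
  ring

end WeightedPerm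

/-- The zero-momentum representation on `ℓ²(ℝ^d)`. -/
def zeroMomentumRep (d : ℕ) : WeylRep d where
  H := lp (fun _ : EuclideanSpace ℝ (Fin d) => ℂ) 2
  nontriv := by
    classical
    exact ⟨lp.single 2 0 1, 0, fun h => by simpa using congrArg (fun f => f 0) h⟩
  -- Shifting by `α` before evaluating the character `e^{-i β·k}` produces the Weyl phase `e^{i
  -- α·β}`.
  U α := (weightedPerm (fun _ => 1) (Equiv.subRight α)).toContinuousLinearMap
  V β := (weightedPerm (fun k => Circle.exp (-⟪β, k⟫_ℝ)) (Equiv.refl _)).toContinuousLinearMap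
  U_zero := by
    ext f k
    simp [weightedPerm_apply]
  V_zero := by
    ext f k
    simp [weightedPerm_apply]
  U_add α α' := by
    ext f k
    simp [weightedPerm_apply, sub_sub]
  V_add β β' := by
    ext f k
    simp [weightedPerm_apply, inner_add_left, Circle.exp_add, mul_comm, mul_left_comm]
  U_star α := by
    rw [star_weightedPerm]
    ext f k
    simp [weightedPerm_apply]
  V_star β := by
    rw [star_weightedPerm]
    ext f k
    simp [weightedPerm_apply, inner_neg_left, ← Circle.exp_neg]
  weyl α β := by
    ext f k
    simp only [mul_apply_eq_comp, LinearIsometry.coe_toContinuousLinearMap,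
      smul_apply, lp.coeFn_smul, Pi.smul_apply, weightedPerm_apply,
      Circle.coe_exp, Circle.coe_one, one_mul, Equiv.subRight_apply, Equiv.refl_apply, smul_eq_mul,
      ← mul_assoc, ← Complex.exp_add]
    congr 2
    rw [inner_sub_right, real_inner_comm α β]
    push_cast
    ring

open Classical in
/-- The unit vector at `0` in `ℓ²(ℝ^d)`. -/
def zeroMomentumVector (d : ℕ) : (zeroMomentumRep d).H :=
  (lp.single 2 0 1 : lp (fun _ : EuclideanSpace ℝ (Fin d) => ℂ) 2)

open Classical in
theorem inner_zeroMomentumVector {d : ℕ} (x : lp (fun _ : EuclideanSpace ℝ (Fin d) => ℂ) 2) :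
    inner ℂ (zeroMomentumVector d) (show (zeroMomentumRep d).H from x) = x 0 := by
  refine (lp.inner_single_left (𝕜 := ℂ) (0 : EuclideanSpace ℝ (Fin d)) (1 : ℂ) x).trans ?_
  simp

/-! ### Vector states and existence of the zero-momentum state -/

namespace WeylAlgebra

variable {d : ℕ}

/-- The functional `a ↦ ⟪x, ρ(a) x⟫`. -/
def vectorFunctional (ρ : WeylRep d) (x : ρ.H) : WeylAlgebra d →ₗ[ℂ] ℂ where
  toFun a := ⟪x, a.eval ρ x⟫_ℂ
  map_add' a b := by rw [eval_add]; exact inner_add_right _ _ _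
  map_smul' z a := by rw [eval_smul]; exact inner_smul_right _ _ _

theorem vectorFunctional_apply (ρ : WeylRep d) (x : ρ.H) (a : WeylAlgebra d) :
    vectorFunctional ρ x a = ⟪x, a.eval ρ x⟫_ℂ := rfl

theorem vectorFunctional_mem_stateSpace (ρ : WeylRep d) {x : ρ.H} (hx : ⟪x, x⟫_ℂ = 1) :
    vectorFunctional ρ x ∈ stateSpace (WeylAlgebra d) := by
  refine ⟨fun a => ?_, ?_⟩
  · rw [vectorFunctional_apply, eval_mul, eval_star, mul_apply_eq_comp,
      ContinuousLinearMap.star_eq_adjoint,  ContinuousLinearMap.adjoint_inner_right, inner_self_eq_norm_sq_to_K, ← RCLike.ofReal_pow]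
    exact Complex.zero_le_real.mpr (sq_nonneg ‖a.eval ρ x‖)
  · rw [vectorFunctional_apply, eval_one]
    exact hx

/-- The zero-momentum state, as a vector state of the zero-momentum representation. -/
def zeroMomentumState (d : ℕ) : WeylAlgebra d →ₗ[ℂ] ℂ :=
  vectorFunctional (zeroMomentumRep d) (zeroMomentumVector d)

open Classical in
theorem isZeroMomentumState_zeroMomentumState (d : ℕ) :
    IsZeroMomentumState (zeroMomentumState d) := by
  refine ⟨vectorFunctional_mem_stateSpace _ ?_, fun α β => ?_⟩
  · refine (inner_zeroMomentumVector _).trans ?_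
    change (lp.single 2 0 1 : lp (fun _ : EuclideanSpace ℝ (Fin d) => ℂ) 2) 0 = 1
    simp
  · rw [zeroMomentumState, vectorFunctional_apply, eval_mul, eval_u, eval_v]
    refine (inner_zeroMomentumVector _).trans ?_
    change ((1 : Circle) : ℂ) * ((Circle.exp (-⟪β, 0 - α⟫_ℝ) : ℂ) *
      (lp.single 2 0 1 : lp (fun _ : EuclideanSpace ℝ (Fin d) => ℂ) 2) (0 - α)) = _
    by_cases h : α = 0
    · subst h
      simp
    · simp [h]

end WeylAlgebra

/-! ### Monomials and the values that determine a state -/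

namespace WeylAlgebra

variable {d : ℕ} {ω ω' : WeylAlgebra d →ₗ[ℂ] ℂ}

theorem star_v_mul_v (β : EuclideanSpace ℝ (Fin d)) : star (v β) * v β = 1 := by
  rw [star_v, v_mul_v, neg_add_cancel, v_zero]

theorem v_mul_star_v (β : EuclideanSpace ℝ (Fin d)) : v β * star (v β) = 1 := by
  rw [star_v, v_mul_v, add_neg_cancel, v_zero]

theorem v_mul_u (α β : EuclideanSpace ℝ (Fin d)) :
    v β * u α = Complex.exp (-(Complex.I * (⟪α, β⟫_ℝ : ℝ))) • (u α * v β) := by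
  rw [u_mul_v, smul_smul, ← Complex.exp_add, neg_add_cancel, Complex.exp_zero, one_smul]

theorem translation_u_mul_v (x α β : EuclideanSpace ℝ (Fin d)) :
    translation x (u α * v β) = Complex.exp (-(Complex.I * (⟪α, x⟫_ℝ : ℝ))) • (u α * v β) := by
  rw [translation, ← mul_assoc, v_mul_u, smul_mul_assoc, smul_mul_assoc, mul_assoc (u α),
    v_mul_v, mul_assoc, star_v, v_mul_v, add_neg_cancel_comm]

/-- The linear span of the monomials `u_α v_β`. -/
def monomialSpan (d : ℕ) : Submodule ℂ (WeylAlgebra d) :=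
  Submodule.span ℂ (Set.range fun p : EuclideanSpace ℝ (Fin d) × EuclideanSpace ℝ (Fin d) =>
    u p.1 * v p.2)

theorem u_mul_v_mem_monomialSpan (α β : EuclideanSpace ℝ (Fin d)) :
    u α * v β ∈ monomialSpan d :=
  Submodule.subset_span ⟨(α, β), rfl⟩

theorem mul_mem_monomialSpan {a b : WeylAlgebra d} (ha : a ∈ monomialSpan d)
    (hb : b ∈ monomialSpan d) : a * b ∈ monomialSpan d := by
  have h : monomialSpan d * monomialSpan d ≤ monomialSpan d := by
    rw [monomialSpan, Submodule.span_mul_span, Submodule.span_le]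
    rintro _ ⟨_, ⟨⟨α, β⟩, rfl⟩, _, ⟨⟨α', β'⟩, rfl⟩, rfl⟩
    have e : u α * v β * (u α' * v β') = Complex.exp (-(Complex.I * (⟪α', β⟫_ℝ : ℝ))) •
        (u (α + α') * v (β + β')) := by
      rw [mul_assoc, ← mul_assoc (v β), v_mul_u, smul_mul_assoc, mul_smul_comm, mul_assoc (u α'),
        v_mul_v, ← mul_assoc, u_mul_u]
    refine (congrArg (· ∈ Submodule.span ℂ _) e).mpr ?_
    exact Submodule.smul_mem _ _ (u_mul_v_mem_monomialSpan _ _)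
  exact h (Submodule.mul_mem_mul ha hb)

theorem star_mem_monomialSpan {a : WeylAlgebra d} (ha : a ∈ monomialSpan d) :
    star a ∈ monomialSpan d := by
  induction ha using Submodule.span_induction with
  | mem a ha =>
    obtain ⟨⟨α, β⟩, rfl⟩ := ha
    rw [star_mul, star_u, star_v, v_mul_u]
    exact Submodule.smul_mem _ _ (u_mul_v_mem_monomialSpan _ _)
  | zero => rw [star_zero]; exact zero_mem _
  | add a b _ _ ha hb => rw [star_add]; exact add_mem ha hb
  | smul z a _ ha => rw [star_smul]; exact Submodule.smul_mem _ _ ha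

/-- By the Weyl relations the span is already closed under products and adjoints, so it contains the
`*`-algebra whose closure defines the Weyl algebra. -/
theorem dense_monomialSpan (d : ℕ) : Dense (monomialSpan d : Set (WeylAlgebra d)) := by
  intro a
  rw [isometry_toProduct.isEmbedding.isInducing.closure_eq_preimage_closure_image]
  have ha : toProduct a ∈ closure (StarAlgebra.adjoin ℂ (Set.range (weylProductU (d := d)) ∪
      Set.range (weylProductV (d := d))) : Set (WeylProduct d)) := toProduct_mem a
  refine closure_mono ?_ ha
  intro x hx
  refine StarAlgebra.adjoin_induction (R := ℂ)
    (p := fun x _ => x ∈ toProduct '' (monomialSpan d : Set (WeylAlgebra d))) ?_ ?_ ?_ ?_ ?_ hx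
  · rintro _ (⟨α, rfl⟩ | ⟨β, rfl⟩)
    · exact ⟨u α, by simpa [v_zero] using u_mul_v_mem_monomialSpan α 0, rfl⟩
    · exact ⟨v β, by simpa [u_zero] using u_mul_v_mem_monomialSpan 0 β, rfl⟩
  · intro z
    refine ⟨z • 1, Submodule.smul_mem _ _ ?_, ?_⟩
    · simpa [u_zero, v_zero] using u_mul_v_mem_monomialSpan (d := d) 0 0
    · rw [map_smul, map_one, Algebra.algebraMap_eq_smul_one]
  · rintro _ _ _ _ ⟨a, ha, rfl⟩ ⟨b, hb, rfl⟩
    exact ⟨a + b, add_mem ha hb, map_add _ _ _⟩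
  · rintro _ _ _ _ ⟨a, ha, rfl⟩ ⟨b, hb, rfl⟩
    exact ⟨a * b, mul_mem_monomialSpan ha hb, map_mul _ _ _⟩
  · rintro _ _ ⟨a, ha, rfl⟩
    exact ⟨star a, star_mem_monomialSpan ha, map_star _ _⟩

/-- A state of the Weyl algebra is determined by its values at the monomials. -/
theorem state_ext (hω : ω ∈ stateSpace (WeylAlgebra d)) (hω' : ω' ∈ stateSpace (WeylAlgebra d))
    (h : ∀ α β, ω (u α * v β) = ω' (u α * v β)) : ω = ω' := by
  refine DFunLike.coe_injective ((continuous_of_nonneg_star_mul_self hω.1).ext_on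
    (dense_monomialSpan d) (continuous_of_nonneg_star_mul_self hω'.1) ?_)
  have : Set.EqOn ω ω' (Set.range fun p : EuclideanSpace ℝ (Fin d) × EuclideanSpace ℝ (Fin d) =>
      u p.1 * v p.2) := by
    rintro _ ⟨⟨α, β⟩, rfl⟩
    exact h α β
  exact LinearMap.eqOn_span this

theorem IsZeroMomentumState.eq (hω : IsZeroMomentumState ω) (hω' : IsZeroMomentumState ω') :
    ω = ω' :=
  state_ext hω.1 hω'.1 fun α β => by rw [hω.2, hω'.2]

theorem IsZeroMomentumState.map_v (hω : IsZeroMomentumState ω) (β : EuclideanSpace ℝ (Fin d)) :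
    ω (v β) = 1 := by
  have := hω.2 0 β
  rwa [u_zero, one_mul, if_pos rfl] at this

/-- Translation-invariant functionals vanish at `u_α` for `α ≠ 0`. -/
theorem map_u_eq_zero_of_translation (h : ∀ x a, ω (translation x a) = ω a)
    {α : EuclideanSpace ℝ (Fin d)} (hα : α ≠ 0) : ω (u α) = 0 := by
  have hinner : ⟪α, α⟫_ℝ ≠ 0 := inner_self_ne_zero.mpr hα
  -- This translation has phase `e^{-iπ} = -1`, so the value equals its own negative.
  have e := h ((Real.pi / ⟪α, α⟫_ℝ) • α) (u α * v 0)
  rw [translation_u_mul_v, v_zero, mul_one, map_smul, inner_smul_right, div_mul_cancel₀ _ hinner,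
    mul_comm, Complex.exp_neg, Complex.exp_pi_mul_I, smul_eq_mul] at e
  norm_num at e
  linear_combination (-1 / 2) * e

/-- A state with `ω(v_β) = 1` for all `β` is the zero-momentum state. -/
theorem isZeroMomentumState_of_map_v (hω : ω ∈ stateSpace (WeylAlgebra d))
    (h : ∀ β, ω (v β) = 1) : IsZeroMomentumState ω := by
  have right : ∀ β a, ω (a * v β) = ω a := fun β a =>
    map_mul_eq_of_map_unitary_eq_one hω (star_v_mul_v β) (h β) a
  have left : ∀ β a, ω (v β * a) = ω a := fun β a => by
    rw [← star_star (v β * a), map_star_of_nonneg_star_mul_self hω.1, star_mul, star_v, right,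
      map_star_of_nonneg_star_mul_self hω.1, Complex.conj_conj]
  refine ⟨hω, fun α β => ?_⟩
  rw [right]
  split_ifs with hα
  · rw [hα, u_zero, hω.2]
  · refine map_u_eq_zero_of_translation (fun x a => ?_) hα
    rw [translation, star_v, right, left]

theorem IsZeroMomentumState.translation_eq (hω : IsZeroMomentumState ω)
    (x : EuclideanSpace ℝ (Fin d)) (a : WeylAlgebra d) : ω (translation x a) = ω a := by
  rw [translation, star_v,
    map_mul_eq_of_map_unitary_eq_one hω.1 (star_v_mul_v _) (hω.map_v _),
    ← star_star (v x * a), map_star_of_nonneg_star_mul_self hω.1.1, star_mul, star_v,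
    map_mul_eq_of_map_unitary_eq_one hω.1 (star_v_mul_v _) (hω.map_v _),
    map_star_of_nonneg_star_mul_self hω.1.1, Complex.conj_conj]

/-! ### Purity of the zero-momentum state -/

/-- The real part of a state at a unitary `v_β` is at most one. -/
theorem re_map_v_le_one (hω : ω ∈ stateSpace (WeylAlgebra d)) (β : EuclideanSpace ℝ (Fin d)) :
    (ω (v β)).re ≤ 1 := by
  have h := hω.1 (v β - 1)
  have e : star (v β - 1) * (v β - 1) = star (v β) * v β - star (v β) - v β + 1 := by
    simp only [star_sub, star_one]; noncomm_ring
  rw [e, star_v_mul_v, map_add, map_sub, map_sub, map_star_of_nonneg_star_mul_self hω.1, hω.2] at h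
  have := (Complex.nonneg_iff.mp h).1
  simp only [Complex.add_re, Complex.sub_re, Complex.one_re, Complex.conj_re] at this
  linarith

/-- Multiplicativity at `v β`, applied to `star (v β) * v β = 1`. -/
theorem star_map_v_mul_map_v_of_pure (hω : ω ∈ pureInvariantStates d)
    (β : EuclideanSpace ℝ (Fin d)) : conj (ω (v β)) * ω (v β) = 1 := by
  rw [← map_star_of_nonneg_star_mul_self hω.2.1.1,
    ← map_mul_unitary_of_mem_pureStates hω.2 (v_mul_star_v β) (hω.1.2 β),
    star_v_mul_v, hω.2.1.2]

/-- The equality case of the bound: `2 - 2 Re ω (v β)` is the value of `ω` at `star (v β - 1) * (v β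
- 1)`, so `v β - 1` is in the left kernel. -/
theorem map_v_eq_one_of_re_map_v_eq_one (hω : ω ∈ stateSpace (WeylAlgebra d))
    (β : EuclideanSpace ℝ (Fin d)) (h : (ω (v β)).re = 1) : ω (v β) = 1 := by
  have hb : ω (star (v β - 1) * (v β - 1)) = 0 := by
    have e : star (v β - 1) * (v β - 1) = star (v β) * v β - star (v β) - v β + 1 := by
      simp only [star_sub, star_one]; noncomm_ring
    rw [e, star_v_mul_v, map_add, map_sub, map_sub, map_star_of_nonneg_star_mul_self hω.1, hω.2]
    apply Complex.ext <;> simp [h]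
  have := map_star_mul_eq_zero_of_nonneg hω.1 hb 1
  rwa [star_one, one_mul, map_sub, hω.2, sub_eq_zero] at this

theorem IsZeroMomentumState.mem_pureStates (hω : IsZeroMomentumState ω) :
    ω ∈ pureStates (WeylAlgebra d) := by
  refine ⟨hω.1, ?_⟩
  rintro ω₁ h₁ ω₂ h₂ ⟨s, t, hs, ht, hst, h⟩
  refine (isZeroMomentumState_of_map_v h₁ fun β => ?_).eq hω
  refine map_v_eq_one_of_re_map_v_eq_one h₁ β ?_
  have e : s * (ω₁ (v β)).re + t * (ω₂ (v β)).re = 1 := by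
    have := congrArg Complex.re (hω.map_v β)
    rw [← h] at this
    simpa using this
  have b₁ := re_map_v_le_one h₁ β
  have b₂ := re_map_v_le_one h₂ β
  refine le_antisymm b₁ ?_
  by_contra! hlt
  nlinarith [mul_lt_mul_of_pos_left hlt hs, mul_le_mul_of_nonneg_left b₂ ht.le]

/-! ### Time reversal and uniqueness -/

theorem timeReversal_one : timeReversal (1 : WeylAlgebra d) = 1 := by
  rw [← v_zero, timeReversal_v]

/-- The time reverse `a ↦ conj (ω (𝔠 a))` of a functional. -/
def timeReverseFunctional (ω : WeylAlgebra d →ₗ[ℂ] ℂ) : WeylAlgebra d →ₗ[ℂ] ℂ where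
  toFun a := conj (ω (timeReversal a))
  map_add' a b := by rw [timeReversal_add, map_add, map_add]
  map_smul' z a := by
    rw [timeReversal_smul, map_smul, smul_eq_mul, map_mul, Complex.conj_conj]
    rfl

theorem timeReverseFunctional_apply (ω : WeylAlgebra d →ₗ[ℂ] ℂ) (a : WeylAlgebra d) :
    timeReverseFunctional ω a = conj (ω (timeReversal a)) := rfl

theorem timeReverseFunctional_mem_stateSpace (hω : ω ∈ stateSpace (WeylAlgebra d)) :
    timeReverseFunctional ω ∈ stateSpace (WeylAlgebra d) := by
  refine ⟨fun a => ?_, ?_⟩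
  · rw [timeReverseFunctional_apply, timeReversal_mul, timeReversal_star]
    exact star_nonneg_iff.mpr (hω.1 _)
  · rw [timeReverseFunctional_apply, timeReversal_one, hω.2, map_one]

theorem IsZeroMomentumState.isTimeReversalInvariant (hω : IsZeroMomentumState ω) :
    IsTimeReversalInvariant ω := by
  have h : timeReverseFunctional ω = ω := by
    refine IsZeroMomentumState.eq ⟨timeReverseFunctional_mem_stateSpace hω.1, fun α β => ?_⟩ hω
    rw [timeReverseFunctional_apply, timeReversal_mul, timeReversal_u, timeReversal_v, hω.2]
    simp only [neg_eq_zero]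
    split_ifs <;> simp
  intro a
  conv_lhs => rw [← h]
  rw [timeReverseFunctional_apply, Complex.conj_conj]

theorem isZeroMomentumState_of_pure_of_timeReversal (hω : ω ∈ pureInvariantStates d)
    (hT : IsTimeReversalInvariant ω) : IsZeroMomentumState ω := by
  refine isZeroMomentumState_of_map_v hω.1.1 fun β => ?_
  -- Reality and unimodularity at `β` alone would allow the value `-1`; passing to `γ = β / 2` turns
  -- `ω (v β)` into the square of a real unimodular number.
  set γ : EuclideanSpace ℝ (Fin d) := (1 / 2 : ℝ) • β with hγ
  have hβ : v β = v γ * v γ := by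
    rw [v_mul_v, hγ, ← add_smul]
    norm_num
  have hreal : conj (ω (v γ)) = ω (v γ) := by rw [hT, timeReversal_v]
  rw [hβ, map_mul_unitary_of_mem_pureStates hω.2 (v_mul_star_v γ) (hω.1.2 γ)]
  nth_rewrite 1 [← hreal]
  exact star_map_v_mul_map_v_of_pure hω γ

end WeylAlgebra

end

theorem mainTheorem12 (d : ℕ) :
    ∃ ω₀ : WeylAlgebra d →ₗ[ℂ] ℂ,
      (∀ ω : WeylAlgebra d →ₗ[ℂ] ℂ, WeylAlgebra.IsZeroMomentumState ω ↔ ω = ω₀) ∧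
      {ω | ω ∈ WeylAlgebra.pureInvariantStates d ∧ WeylAlgebra.IsTimeReversalInvariant ω} =
        {ω₀} := by
  have h₀ := WeylAlgebra.isZeroMomentumState_zeroMomentumState d
  refine ⟨WeylAlgebra.zeroMomentumState d, fun ω => ⟨fun h => h.eq h₀, fun h => h ▸ h₀⟩, ?_⟩
  ext ω
  rw [Set.mem_singleton_iff]
  constructor
  · rintro ⟨hω, hT⟩
    exact (WeylAlgebra.isZeroMomentumState_of_pure_of_timeReversal hω hT).eq h₀
  · rintro rfl
    exact ⟨⟨⟨h₀.1, h₀.translation_eq⟩, h₀.mem_pureStates⟩, h₀.isTimeReversalInvariant⟩
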